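/- Let $H$ be a complex Hilbert space and let $S$ be a positive, densely defined, closed operator in $H$. Let $T=(I-S)(I+S)^{-1}$ be its Cayley transform, a symmetric contraction defined on the closed subspace $\operatorname{dom}(T)=\operatorname{ran}(I+S)$. For a contraction $C\colon H_1\to H_2$ between Hilbert spaces write $D_C=(I-C^*C)^{1/2}$ and $\mathcal D_C=\overline{D_C H_1}$. With respect to $H=\operatorname{dom}(T)\oplus(H\ominus\operatorname{dom}(T))$, write $T=\begin{bmatrix}A\\ \Gamma_2D_A\end{bmatrix}$, where $A\colon\operatorname{dom}(T)\to\operatorname{dom}(T)$ is a selfadjoint contraction and $\Gamma_2\colon\mathcal D_A\to H\ominus\operatorname{dom}(T)$ is a contraction, both uniquely determined by $T$. For a selfadjoint contraction $\Gamma$ on $\mathcal D_{\Gamma_2^*}$ put $$\widetilde T(\Gamma)=\begin{bmatrix}A & D_A\Gamma_2^*\\ \Gamma_2D_A & -\Gamma_2A^*\Gamma_2^*+D_{\Gamma_2^*}\Gamma D_{\Gamma_2^*}\end{bmatrix},\qquad \widetilde S(\Gamma)=(I-\widetilde T(\Gamma))(I+\widetilde T(\Gamma))^{-1},\quad \operatorname{dom}(\widetilde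 S(\Gamma))=\operatorname{ran}(I+\widetilde T(\Gamma)),$$ and let $\widetilde S_{\mathrm F}=\widetilde S(-I)$, where $I$ is the identity of $\mathcal D_{\Gamma_2^*}$. Let $F$ be the Friedrichs extension of $S$, that is, the restriction of $S^*$ to the set of all $\xi\in\operatorname{dom}(S^*)$ for which there is a sequence $(\xi_n)_{n\in\mathbb N}$ in $\operatorname{dom}(S)$ with $\xi_n\to\xi$ as $n\to\infty$ and $\langle \xi_n-\xi_m,S(\xi_n-\xi_m)\rangle\to0$ as $m,n\to\infty$. Then $\widetilde S_{\mathrm F}=F$; that is, the two operators have the same domain and coincide on it. -/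

import Mathlib

noncomputable section

open scoped InnerProductSpace
open Filter Topology ContinuousLinearMap

namespace KreinFriedrichs

set_option linter.unusedSectionVars false

variable {E F H : Type*} [NormedAddCommGroup E] [InnerProductSpace ℂ E] [CompleteSpace E]
  [NormedAddCommGroup F] [InnerProductSpace ℂ F] [CompleteSpace F]
  [NormedAddCommGroup H] [InnerProductSpace ℂ H] [CompleteSpace H]

/-! ### Defect operators -/

/-- The defect operator `D_C = (I - C* C)^{1/2}` of a contraction `C : E → F`. -/
def defect (C : E →L[ℂ] F) : E →L[ℂ] E :=
  CFC.sqrt (1 - adjoint C ∘L C)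

/-- The defect space `𝒟_C`, the closure of the range of `D_C`. -/
def defectSpace (C : E →L[ℂ] F) : Submodule ℂ E :=
  (LinearMap.range (defect C).toLinearMap).topologicalClosure

instance (C : E →L[ℂ] F) : CompleteSpace (defectSpace C) :=
  Submodule.topologicalClosure.completeSpace _

/-- The defect operator `D_C`, regarded as an operator `E → 𝒟_C`. -/
def defectTo (C : E →L[ℂ] F) : E →L[ℂ] defectSpace C :=
  (defect C).codRestrict (defectSpace C)
    fun x => Submodule.le_topologicalClosure _ (LinearMap.mem_range_self _ x)

theorem denseRange_defectTo (C : E →L[ℂ] F) : DenseRange (defectTo C) := by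
  intro y
  rw [Metric.mem_closure_range_iff]
  intro ε hε
  have hy : (y : E) ∈ closure (Set.range (defect C)) := y.2
  obtain ⟨x, hx⟩ := Metric.mem_closure_range_iff.1 hy ε hε
  exact ⟨x, hx⟩

theorem norm_defectTo_sq (C : E →L[ℂ] F) (hC : ‖C‖ ≤ 1) (x : E) :
    ‖defectTo C x‖ ^ 2 = ‖x‖ ^ 2 - ‖C x‖ ^ 2 := by
  have hpos : (0 : E →L[ℂ] E) ≤ 1 - adjoint C ∘L C := by
    rw [nonneg_iff_isPositive, isPositive_def']
    refine ⟨?_, fun y => ?_⟩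
    · rw [IsSelfAdjoint, star_sub, star_one, star_eq_adjoint, adjoint_comp, adjoint_adjoint]
    · have h1 : ‖C y‖ ≤ ‖y‖ := by simpa using C.le_of_opNorm_le hC y
      have h2 : ‖C y‖ ^ 2 ≤ ‖y‖ ^ 2 := by gcongr
      simp only [reApplyInnerSelf_apply, sub_apply, one_apply_eq_self, comp_apply, inner_sub_left,
        adjoint_inner_left, map_sub, inner_self_eq_norm_sq]
      linarith
  have hsa : adjoint (defect C) = defect C :=
    (IsSelfAdjoint.of_nonneg (CFC.sqrt_nonneg (1 - adjoint C ∘L C))).star_eq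
  have hsq : defect C ∘L defect C = 1 - adjoint C ∘L C := CFC.sqrt_mul_sqrt_self _ hpos
  calc ‖defectTo C x‖ ^ 2 = RCLike.re ⟪defect C x, defect C x⟫_ℂ :=
        (inner_self_eq_norm_sq (𝕜 := ℂ) (defect C x)).symm
    _ = RCLike.re ⟪(defect C ∘L defect C) x, x⟫_ℂ := by
        conv_rhs => rw [comp_apply, ← hsa, adjoint_inner_left, hsa]
    _ = ‖x‖ ^ 2 - ‖C x‖ ^ 2 := by
        rw [hsq]
        simp only [sub_apply, one_apply_eq_self, comp_apply, inner_sub_left,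
          adjoint_inner_left, map_sub, inner_self_eq_norm_sq]

/-! ### Selfadjoint contractive extensions of a symmetric contraction -/

section Completion

variable {K : Submodule ℂ H} [CompleteSpace K] (T : K →L[ℂ] H)

/-- The corner `A = P_K T` of `T = [A; Γ₂ D_A] : K → K ⊕ Kᗮ`. -/
def cornerA : K →L[ℂ] K := K.orthogonalProjectionOnto ∘L T

/-- The contraction `Γ₂ : 𝒟_A → Kᗮ` with `Γ₂ D_A = (I - P_K) T`, obtained from this equation on the
dense range of `D_A` by continuous extension. -/
def gammaTwo : defectSpace (cornerA T) →L[ℂ] Kᗮ :=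
  (Kᗮ.orthogonalProjectionOnto ∘L T).toLinearMap.extendOfNorm (defectTo (cornerA T)).toLinearMap

theorem norm_cornerA_le (hT : ‖T‖ ≤ 1) : ‖cornerA T‖ ≤ 1 :=
  (opNorm_comp_le _ _).trans
    (mul_le_one₀ K.orthogonalProjectionOnto_norm_le (norm_nonneg _) hT)

theorem norm_projection_le (hT : ‖T‖ ≤ 1) (x : K) :
    ‖Kᗮ.orthogonalProjectionOnto (T x)‖ ≤ ‖defectTo (cornerA T) x‖ := by
  have h1 : ‖T x‖ ≤ ‖x‖ := by simpa using T.le_of_opNorm_le hT x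
  have h2 : ‖T x‖ ^ 2 ≤ ‖x‖ ^ 2 := pow_le_pow_left₀ (norm_nonneg _) h1 2
  have h3 : ‖T x‖ ^ 2 = ‖cornerA T x‖ ^ 2 + ‖Kᗮ.orthogonalProjectionOnto (T x)‖ ^ 2 :=
    Submodule.norm_sq_eq_add_norm_sq_projection (T x) K
  have h4 := norm_defectTo_sq (cornerA T) (norm_cornerA_le T hT) x
  exact le_of_sq_le_sq (by linarith) (norm_nonneg _)

/-- If `T` is a contraction, `gammaTwo T` satisfies its defining equation. -/
theorem gammaTwo_defectTo (hT : ‖T‖ ≤ 1) (x : K) :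
    gammaTwo T (defectTo (cornerA T) x) = Kᗮ.orthogonalProjectionOnto (T x) :=
  LinearMap.extendOfNorm_eq (f := (Kᗮ.orthogonalProjectionOnto ∘L T).toLinearMap)
    (e := (defectTo (cornerA T)).toLinearMap) (denseRange_defectTo (cornerA T))
    ⟨1, fun x => (norm_projection_le T hT x).trans_eq (one_mul _).symm⟩ x

/-- If `T` is a contraction, so is `gammaTwo T`. -/
theorem norm_gammaTwo_le (hT : ‖T‖ ≤ 1) : ‖gammaTwo T‖ ≤ 1 :=
  LinearMap.opNorm_extendOfNorm_le (f := (Kᗮ.orthogonalProjectionOnto ∘L T).toLinearMap)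
    (e := (defectTo (cornerA T)).toLinearMap) (denseRange_defectTo (cornerA T)) zero_le_one
    (fun x => (norm_projection_le T hT x).trans_eq (one_mul _).symm)

/-- The lower right corner `-Γ₂ A* Γ₂* + D_{Γ₂*} Γ D_{Γ₂*} : Kᗮ → Kᗮ`. As `A` is selfadjoint for a
symmetric contraction `T`, `A*` maps `𝒟_A` into itself; the projection onto `𝒟_A` only adjusts the
codomain. -/
def cornerX (Γ : defectSpace (adjoint (gammaTwo T)) →L[ℂ] defectSpace (adjoint (gammaTwo T))) :
    Kᗮ →L[ℂ] Kᗮ :=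
  -(gammaTwo T ∘L (defectSpace (cornerA T)).orthogonalProjectionOnto ∘L adjoint (cornerA T) ∘L
      (defectSpace (cornerA T)).subtypeL ∘L adjoint (gammaTwo T))
    + (defect (adjoint (gammaTwo T)) ∘L (defectSpace (adjoint (gammaTwo T))).subtypeL ∘L Γ ∘L
        defectTo (adjoint (gammaTwo T)))

/-- The operator `T̃(Γ)` on `H = K ⊕ Kᗮ` with block matrix
`[A, D_A Γ₂*; Γ₂ D_A, -Γ₂ A* Γ₂* + D_{Γ₂*} Γ D_{Γ₂*}]`. -/
def tildeT (Γ : defectSpace (adjoint (gammaTwo T)) →L[ℂ] defectSpace (adjoint (gammaTwo T))) :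
    H →L[ℂ] H :=
  K.subtypeL ∘L
      (cornerA T ∘L K.orthogonalProjectionOnto
        + defect (cornerA T) ∘L (defectSpace (cornerA T)).subtypeL ∘L adjoint (gammaTwo T) ∘L
            Kᗮ.orthogonalProjectionOnto)
    + Kᗮ.subtypeL ∘L
      (gammaTwo T ∘L defectTo (cornerA T) ∘L K.orthogonalProjectionOnto
        + cornerX T Γ ∘L Kᗮ.orthogonalProjectionOnto)

end Completion

/-! ### The Cayley transform -/

/-- The Cayley transform `(I - R)(I + R)⁻¹`, with domain `ran (I + R)`, of a partially defined
operator `R` for which `I + R` is injective: it maps `h + R h` to `h - R h`. The inverse Cayley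
transform is given by the same formula. -/
def cayley (R : H →ₗ.[ℂ] H) : H →ₗ.[ℂ] H :=
  (LinearMap.range ((R.domain.subtype + R.toFun).prod (R.domain.subtype - R.toFun))).toLinearPMap

variable (H) in
/-- Positive, closed, densely defined operators on `H`. -/
structure PositiveClosedOperator where
  /-- the underlying partially defined operator -/
  op : H →ₗ.[ℂ] H
  dense : Dense (op.domain : Set H)
  closed : op.IsClosed
  symmetric : op.IsFormalAdjoint op
  nonneg : ∀ x : op.domain, 0 ≤ RCLike.re ⟪op x, (x : H)⟫_ℂ

namespace PositiveClosedOperator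

variable (S : PositiveClosedOperator H)

theorem norm_sub_le (h : S.op.domain) : ‖(h : H) - S.op h‖ ≤ ‖(h : H) + S.op h‖ := by
  refine le_of_sq_le_sq ?_ (norm_nonneg _)
  have h0 := S.nonneg h
  rw [inner_re_symm] at h0
  rw [norm_sub_sq (𝕜 := ℂ), norm_add_sq (𝕜 := ℂ)]
  linarith

theorem norm_le (h : S.op.domain) :
    ‖(h : H)‖ ≤ ‖(h : H) + S.op h‖ ∧ ‖S.op h‖ ≤ ‖(h : H) + S.op h‖ := by
  have h0 := S.nonneg h
  rw [inner_re_symm] at h0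
  have h1 := norm_add_sq (𝕜 := ℂ) (h : H) (S.op h)
  constructor <;> refine le_of_sq_le_sq ?_ (norm_nonneg _)
  · nlinarith [sq_nonneg ‖S.op h‖]
  · nlinarith [sq_nonneg ‖(h : H)‖]

theorem graph_cayley : (cayley S.op).graph = LinearMap.range
    ((S.op.domain.subtype + S.op.toFun).prod (S.op.domain.subtype - S.op.toFun)) := by
  refine Submodule.toLinearPMap_graph_eq _ ?_
  rintro ⟨x, y⟩ ⟨h, hh⟩ (rfl : x = 0)
  have h1 : (h : H) + S.op h = 0 := congrArg Prod.fst hh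
  have h2 : (h : H) - S.op h = y := congrArg Prod.snd hh
  have h3 := S.norm_sub_le h
  rw [h1, h2, norm_zero] at h3
  exact norm_le_zero_iff.1 h3

theorem mem_domain_cayley (x : H) :
    x ∈ (cayley S.op).domain ↔ ∃ h : S.op.domain, (h : H) + S.op h = x := by
  rw [LinearPMap.mem_domain_iff, S.graph_cayley]
  constructor
  · rintro ⟨y, h, hh⟩
    exact ⟨h, congrArg Prod.fst hh⟩
  · rintro ⟨h, rfl⟩
    exact ⟨_, h, rfl⟩

theorem cayley_apply (h : S.op.domain) (hx : (h : H) + S.op h ∈ (cayley S.op).domain) :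
    cayley S.op ⟨(h : H) + S.op h, hx⟩ = (h : H) - S.op h := by
  have h1 : ((h : H) + S.op h, (h : H) - S.op h) ∈ (cayley S.op).graph := by
    rw [S.graph_cayley]; exact ⟨h, rfl⟩
  exact ((LinearPMap.image_iff hx).2 h1).symm

theorem norm_cayley_le (x : (cayley S.op).domain) : ‖cayley S.op x‖ ≤ 1 * ‖x‖ := by
  obtain ⟨x, hx⟩ := x
  obtain ⟨h, rfl⟩ := (S.mem_domain_cayley x).1 hx
  rw [S.cayley_apply h hx, one_mul]
  exact S.norm_sub_le h

instance : CompleteSpace (cayley S.op).domain := by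
  refine IsComplete.completeSpace_coe (s := ((cayley S.op).domain : Set H)) ?_
  have : CompleteSpace S.op.graph := completeSpace_coe_iff_isComplete.2 S.closed.isComplete
  let f : S.op.graph →L[ℂ] H :=
    (ContinuousLinearMap.fst ℂ H H + ContinuousLinearMap.snd ℂ H H) ∘L S.op.graph.subtypeL
  have hf : AntilipschitzWith 1 f := by
    refine ContinuousLinearMap.antilipschitz_of_bound f fun z => ?_
    obtain ⟨⟨x, y⟩, hz⟩ := z
    obtain ⟨h, rfl, rfl⟩ := (LinearPMap.mem_graph_iff _).1 hz
    rw [NNReal.coe_one, one_mul]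
    exact max_le (S.norm_le h).1 (S.norm_le h).2
  have hr : ((cayley S.op).domain : Set H) = Set.range f := by
    ext x
    rw [SetLike.mem_coe, S.mem_domain_cayley]
    constructor
    · rintro ⟨h, rfl⟩
      exact ⟨⟨_, S.op.mem_graph h⟩, rfl⟩
    · rintro ⟨⟨⟨x, y⟩, hz⟩, rfl⟩
      obtain ⟨h, rfl, rfl⟩ := (LinearPMap.mem_graph_iff _).1 hz
      exact ⟨h, rfl⟩
  rw [hr]
  exact hf.isComplete_range f.uniformContinuous

/-- The Cayley transform `T = C(S)` of `S`, as a bounded operator `dom T = ran (I + S) → H`. -/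
def T : (cayley S.op).domain →L[ℂ] H :=
  (cayley S.op).toFun.mkContinuous 1 S.norm_cayley_le

theorem norm_T_le : ‖S.T‖ ≤ 1 :=
  LinearMap.mkContinuous_norm_le _ zero_le_one _

/-- The extension `S̃(Γ) = C⁻¹(T̃(Γ))` of `S`, for `Γ` an operator on `𝒟_{Γ₂*}`; it is meant for
selfadjoint contractions `Γ`. -/
def extension
    (Γ : defectSpace (adjoint (gammaTwo S.T)) →L[ℂ] defectSpace (adjoint (gammaTwo S.T))) :
    H →ₗ.[ℂ] H :=
  cayley ((tildeT S.T Γ).toLinearMap.toPMap ⊤)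

theorem norm_form_add_le (x y : S.op.domain) :
    ‖⟪((x + y : S.op.domain) : H), S.op (x + y)⟫_ℂ‖
      ≤ 2 * ‖⟪(x : H), S.op x⟫_ℂ‖ + 2 * ‖⟪(y : H), S.op y⟫_ℂ‖ := by
  have key : ∀ z : S.op.domain, ‖⟪(z : H), S.op z⟫_ℂ‖ = RCLike.re ⟪(z : H), S.op z⟫_ℂ := by
    intro z
    have h1 : starRingEnd ℂ ⟪(z : H), S.op z⟫_ℂ = ⟪(z : H), S.op z⟫_ℂ := by
      rw [inner_conj_symm]; exact S.symmetric z z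
    have h0 := S.nonneg z
    rw [inner_re_symm] at h0
    rw [← RCLike.conj_eq_iff_re.1 h1, RCLike.norm_ofReal, RCLike.ofReal_re, abs_of_nonneg h0]
  have h0 := S.nonneg (x - y)
  rw [inner_re_symm] at h0
  rw [key, key, key]
  simp only [LinearPMap.map_add, LinearPMap.map_sub, Submodule.coe_add, Submodule.coe_sub,
    inner_add_left, inner_add_right, inner_sub_left, inner_sub_right, map_add, map_sub] at h0 ⊢
  linarith

/-- The domain of the Friedrichs extension: all `ξ ∈ dom S*` for which there is a sequence `ξₙ` in
`dom S` with `ξₙ → ξ` and `⟨ξₙ - ξₘ, S (ξₙ - ξₘ)⟩ → 0` as `m, n → ∞`. -/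
def friedrichsDomain : Submodule ℂ H where
  carrier := {ξ | ξ ∈ S.op.adjoint.domain ∧ ∃ u : ℕ → S.op.domain,
    Tendsto (fun n => (u n : H)) atTop (𝓝 ξ) ∧
    Tendsto (fun p : ℕ × ℕ => ⟪((u p.1 - u p.2 : S.op.domain) : H), S.op (u p.1 - u p.2)⟫_ℂ)
      atTop (𝓝 0)}
  zero_mem' := ⟨zero_mem _, fun _ => 0, by simp, by simp⟩
  add_mem' := by
    rintro x y ⟨hx, u, hu, hu'⟩ ⟨hy, v, hv, hv'⟩
    refine ⟨add_mem hx hy, fun n => u n + v n, by simpa using hu.add hv, ?_⟩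
    rw [tendsto_zero_iff_norm_tendsto_zero] at hu' hv' ⊢
    have hlim := (hu'.const_mul 2).add (hv'.const_mul 2)
    rw [mul_zero, add_zero] at hlim
    refine squeeze_zero (fun _ => norm_nonneg _) (fun p => ?_) hlim
    have := S.norm_form_add_le (u p.1 - u p.2) (v p.1 - v p.2)
    rwa [← add_sub_add_comm] at this
  smul_mem' := by
    rintro c x ⟨hx, u, hu, hu'⟩
    refine ⟨Submodule.smul_mem _ c hx, fun n => c • u n, by simpa using hu.const_smul c, ?_⟩
    have := hu'.const_mul (c * starRingEnd ℂ c)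
    rw [mul_zero] at this
    refine this.congr fun p => ?_
    rw [← smul_sub, LinearPMap.map_smul, Submodule.coe_smul, inner_smul_left, inner_smul_right]
    ring

/-- The Friedrichs extension `F` of `S`: the restriction of `S*` to `friedrichsDomain`. -/
def friedrichs : H →ₗ.[ℂ] H :=
  S.op.adjoint.domRestrict S.friedrichsDomain

end PositiveClosedOperator

end KreinFriedrichs

end

noncomputable section

open scoped InnerProductSpace
open Filter Topology ContinuousLinearMap

namespace KreinFriedrichs

set_option linter.unusedSectionVars false

variable {E F H : Type*} [NormedAddCommGroup E] [InnerProductSpace ℂ E] [CompleteSpace E]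
  [NormedAddCommGroup F] [InnerProductSpace ℂ F] [CompleteSpace F]
  [NormedAddCommGroup H] [InnerProductSpace ℂ H] [CompleteSpace H]

/-! Write `R` for T̃(-I). The choice Γ = -I makes I + R = V*V with V = [(I+A)^{1/2}, (I-A)^{1/2}Γ₂*]
(`adjoint_tildeTFactor_comp_self`), and V maps K = ran(I+S) onto a dense part of ran V
(`tildeTFactor_mem_closure`). The rest needs only these two facts and that R extends T
(`cayley_eq_friedrichs`). Given x, choose hₙ in dom S with V(hₙ + Shₙ) → Vx. Applying V* gives 2hₙ →
x + Rx, and the form of S at 2h is a continuous function of V(h + Sh), so (2hₙ) is Cauchy for the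
form. Hence S̃_F ⊆ F. Equality follows because I + S̃_F is onto while I + F is injective
(`eq_zero_of_mem_friedrichsDomain`). -/

/-! ### Defect operators and the square roots of I ± A. -/

theorem one_sub_adjoint_comp_self_nonneg (C : E →L[ℂ] F) (hC : ‖C‖ ≤ 1) :
    (0 : E →L[ℂ] E) ≤ 1 - adjoint C ∘L C := by
  rw [nonneg_iff_isPositive, isPositive_def']
  refine ⟨?_, fun y => ?_⟩
  · rw [IsSelfAdjoint, star_sub, star_one, star_eq_adjoint, adjoint_comp, adjoint_adjoint]
  · have h1 : ‖C y‖ ≤ ‖y‖ := by simpa using C.le_of_opNorm_le hC y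
    have h2 : ‖C y‖ ^ 2 ≤ ‖y‖ ^ 2 := by gcongr
    simp only [reApplyInnerSelf_apply, sub_apply, one_apply_eq_self, comp_apply, inner_sub_left,
      adjoint_inner_left, map_sub, inner_self_eq_norm_sq]
    linarith

theorem defect_defect_apply (C : E →L[ℂ] F) (hC : ‖C‖ ≤ 1) (x : E) :
    defect C (defect C x) = x - adjoint C (C x) := by
  have h : defect C * defect C = 1 - adjoint C ∘L C :=
    CFC.sqrt_mul_sqrt_self _ (one_sub_adjoint_comp_self_nonneg C hC)
  simpa using congrArg (fun f : E →L[ℂ] E => f x) h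

theorem one_add_nonneg_of_norm_le_one {A : E →L[ℂ] E} (hA : IsSelfAdjoint A) (hA' : ‖A‖ ≤ 1) :
    0 ≤ 1 + A := by
  rw [nonneg_iff_isPositive, isPositive_def']
  refine ⟨(IsSelfAdjoint.one _).add hA, fun y => ?_⟩
  have h1 : ‖A y‖ ≤ ‖y‖ := by simpa using A.le_of_opNorm_le hA' y
  have h2 : -(‖A y‖ * ‖y‖) ≤ RCLike.re ⟪A y, y⟫_ℂ :=
    neg_le_of_abs_le ((RCLike.abs_re_le_norm _).trans (norm_inner_le_norm _ _))
  simp only [reApplyInnerSelf_apply, add_apply, one_apply_eq_self, inner_add_left, map_add,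
    inner_self_eq_norm_sq]
  nlinarith [norm_nonneg y]

/-- The square root `(I + A)^{1/2}`, for a selfadjoint contraction `A`. -/
def sqrtOneAdd (A : E →L[ℂ] E) : E →L[ℂ] E := CFC.sqrt (1 + A)

theorem adjoint_sqrtOneAdd (A : E →L[ℂ] E) : adjoint (sqrtOneAdd A) = sqrtOneAdd A :=
  (IsSelfAdjoint.of_nonneg (CFC.sqrt_nonneg (1 + A))).star_eq

theorem sqrtOneAdd_sqrtOneAdd {A : E →L[ℂ] E} (hA : IsSelfAdjoint A) (hA' : ‖A‖ ≤ 1) (x : E) :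
    sqrtOneAdd A (sqrtOneAdd A x) = x + A x :=
  congrArg (fun f : E →L[ℂ] E => f x)
    (CFC.sqrt_mul_sqrt_self _ (one_add_nonneg_of_norm_le_one hA hA'))

theorem commute_sqrtOneAdd_neg (A : E →L[ℂ] E) :
    Commute (sqrtOneAdd A) (sqrtOneAdd (-A)) := by
  have h : Commute (1 + A) (1 + -A) :=
    (Commute.one_left _).add_left ((Commute.one_right A).add_right (Commute.refl A).neg_right)
  exact ((h.cfcₙ_nnreal _).symm.cfcₙ_nnreal _).symm

/-- Since I - A² = (I+A)(I-A) and the two roots commute, their product is a positive square root of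
I - A*A; such a root is unique. -/
theorem defect_eq_sqrtOneAdd_mul {A : E →L[ℂ] E} (hA : IsSelfAdjoint A) (hA' : ‖A‖ ≤ 1) :
    defect A = sqrtOneAdd A * sqrtOneAdd (-A) := by
  have hc := commute_sqrtOneAdd_neg A
  refine CFC.sqrt_unique ?_ (hc.mul_nonneg (CFC.sqrt_nonneg _) (CFC.sqrt_nonneg _))
  ext x
  have h1 : sqrtOneAdd (-A) (sqrtOneAdd A (sqrtOneAdd (-A) x))
      = sqrtOneAdd A (sqrtOneAdd (-A) (sqrtOneAdd (-A) x)) :=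
    congrArg (fun f : E →L[ℂ] E => f (sqrtOneAdd (-A) x)) hc.eq.symm
  simp only [mul_apply_eq_comp, h1, sqrtOneAdd_sqrtOneAdd hA hA',
    sqrtOneAdd_sqrtOneAdd hA.neg (norm_neg A ▸ hA'), show adjoint A = A from hA.star_eq,
    sub_apply, one_apply_eq_self, comp_apply, neg_apply, map_add, map_neg]
  abel

theorem sqrtOneAdd_sqrtOneAdd_neg {A : E →L[ℂ] E} (hA : IsSelfAdjoint A) (hA' : ‖A‖ ≤ 1)
    (x : E) : sqrtOneAdd A (sqrtOneAdd (-A) x) = defect A x := by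
  rw [defect_eq_sqrtOneAdd_mul hA hA']; rfl

theorem sqrtOneAdd_neg_sqrtOneAdd {A : E →L[ℂ] E} (hA : IsSelfAdjoint A) (hA' : ‖A‖ ≤ 1)
    (x : E) : sqrtOneAdd (-A) (sqrtOneAdd A x) = defect A x := by
  rw [defect_eq_sqrtOneAdd_mul hA hA', (commute_sqrtOneAdd_neg A).eq]; rfl

/-- On ran D_A one has (I-A)^{1/2} D_A y = (I+A)^{1/2} (I-A) y; continuity extends this to the
closure. -/
theorem sqrtOneAdd_neg_mem_closure_range {A : E →L[ℂ] E} (hA : IsSelfAdjoint A) (hA' : ‖A‖ ≤ 1)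
    {x : E} (hx : x ∈ defectSpace A) :
    sqrtOneAdd (-A) x ∈ (LinearMap.range (sqrtOneAdd A).toLinearMap).topologicalClosure := by
  refine map_mem_closure (sqrtOneAdd (-A)).continuous hx ?_
  rintro _ ⟨y, rfl⟩
  refine ⟨sqrtOneAdd (-A) (sqrtOneAdd (-A) y), ?_⟩
  change _ = sqrtOneAdd (-A) (defect A y)
  rw [← sqrtOneAdd_sqrtOneAdd_neg hA hA' y, sqrtOneAdd_neg_sqrtOneAdd hA hA']
  exact sqrtOneAdd_sqrtOneAdd_neg hA hA' _

/-- The factorization of `I + T̃(-I)`, as an identity between block operators on `E ⊕ F`. -/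
theorem adjoint_comp_self_eq_block {D G : Type*} [NormedAddCommGroup D] [InnerProductSpace ℂ D]
    [CompleteSpace D] [NormedAddCommGroup G] [InnerProductSpace ℂ G] [CompleteSpace G]
    {A : E →L[ℂ] E} (hA : IsSelfAdjoint A) (hA' : ‖A‖ ≤ 1) {ι : D →L[ℂ] E} {ι' δ : E →L[ℂ] D}
    (hι' : adjoint ι = ι') (hι : ∀ x, ι' (ι x) = x) (hδ : ∀ x, ι (δ x) = defect A x) {Γ : D →L[ℂ] F}
    {κ : G →L[ℂ] F} {ε : F →L[ℂ] G} (hΓ : ‖adjoint Γ‖ ≤ 1)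
    (hε : ∀ x, κ (ε x) = defect (adjoint Γ) x)
    {p : H →L[ℂ] E} {p' : E →L[ℂ] H} {q : H →L[ℂ] F} {q' : F →L[ℂ] H} (hp : adjoint p = p')
    (hq : adjoint q = q') (hpq : ∀ x, p' (p x) + q' (q x) = x) (x : H) :
    adjoint (sqrtOneAdd A ∘L p + sqrtOneAdd (-A) ∘L ι ∘L adjoint Γ ∘L q)
        ((sqrtOneAdd A ∘L p + sqrtOneAdd (-A) ∘L ι ∘L adjoint Γ ∘L q) x)
      = x + (p' ∘L (A ∘L p + defect A ∘L ι ∘L adjoint Γ ∘L q)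
        + q' ∘L (Γ ∘L δ ∘L p
          + (-(Γ ∘L ι' ∘L adjoint A ∘L ι ∘L adjoint Γ)
            + (defect (adjoint Γ) ∘L κ ∘L (-1 : G →L[ℂ] G) ∘L ε)) ∘L q)) x := by
  have h1 (y : E) : ι' (defect A y) = δ y := by rw [← hδ, hι]
  -- With -I in the corner, this square reduces the identity of `F` to ΓΓ*, so the lower right entry
  -- becomes Γ(I-A)Γ*.
  have h2 (y : F) : defect (adjoint Γ) (defect (adjoint Γ) y) = y - Γ (adjoint Γ y) := by
    rw [defect_defect_apply _ hΓ, adjoint_adjoint]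
  conv_rhs => enter [1]; rw [← hpq x]
  simp only [map_add, adjoint_comp, adjoint_sqrtOneAdd, adjoint_adjoint, hp, hq, hι', add_apply, comp_apply,
    sqrtOneAdd_sqrtOneAdd hA hA', sqrtOneAdd_sqrtOneAdd hA.neg (norm_neg A ▸ hA'),
    sqrtOneAdd_sqrtOneAdd_neg hA hA', sqrtOneAdd_neg_sqrtOneAdd hA hA', h1, hι, hε, h2,
    neg_apply, one_apply_eq_self, map_neg, map_sub, show adjoint A = A from hA.star_eq]
  abel

/-! ### The factorization of I + T̃(-I) and the density of V(K). -/

section Completion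

variable {K : Submodule ℂ H} [CompleteSpace K] (T : K →L[ℂ] H)

theorem isSelfAdjoint_cornerA (hsym : ∀ x y : K, ⟪T x, (y : H)⟫_ℂ = ⟪(x : H), T y⟫_ℂ) :
    IsSelfAdjoint (cornerA T) := by
  rw [isSelfAdjoint_iff_isSymmetric]
  intro x y
  change ⟪K.orthogonalProjectionOnto (T x), y⟫_ℂ = ⟪x, K.orthogonalProjectionOnto (T y)⟫_ℂ
  rw [Submodule.inner_orthogonalProjectionOnto_eq_of_mem_right,
    Submodule.inner_orthogonalProjectionOnto_eq_of_mem_left, hsym]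

/-- The operator `[(I + A)^{1/2}, (I - A)^{1/2} Γ₂*] : K ⊕ Kᗮ → K`, which factorizes
`I + T̃(-I)`. -/
def tildeTFactor : H →L[ℂ] K :=
  sqrtOneAdd (cornerA T) ∘L K.orthogonalProjectionOnto
    + sqrtOneAdd (-cornerA T) ∘L (defectSpace (cornerA T)).subtypeL ∘L adjoint (gammaTwo T) ∘L
        Kᗮ.orthogonalProjectionOnto

theorem orthogonalProjectionOnto_orthogonal_coe (x : K) :
    Kᗮ.orthogonalProjectionOnto (x : H) = 0 :=
  Submodule.orthogonalProjectionOnto_orthogonal_apply_eq_zero x.2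

theorem coe_projection_add_coe_projection_orthogonal (x : H) :
    (K.orthogonalProjectionOnto x : H) + (Kᗮ.orthogonalProjectionOnto x : H) = x :=
  K.starProjection_add_starProjection_orthogonal x

theorem tildeTFactor_coe (x : K) : tildeTFactor T x = sqrtOneAdd (cornerA T) x := by
  simp only [tildeTFactor, add_apply, comp_apply, map_zero, add_zero,
    Submodule.orthogonalProjectionOnto_mem_subspace_eq_self,
    orthogonalProjectionOnto_orthogonal_coe]

theorem tildeT_coe (hT : ‖T‖ ≤ 1)
    (Γ : defectSpace (adjoint (gammaTwo T)) →L[ℂ] defectSpace (adjoint (gammaTwo T))) (x : K) :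
    tildeT T Γ x = T x := by
  simp only [tildeT, add_apply, comp_apply, Submodule.orthogonalProjectionOnto_mem_subspace_eq_self,
    orthogonalProjectionOnto_orthogonal_coe, gammaTwo_defectTo T hT, map_zero, add_zero]
  exact coe_projection_add_coe_projection_orthogonal (T x)

theorem adjoint_tildeTFactor_comp_self (hT : ‖T‖ ≤ 1)
    (hsym : ∀ x y : K, ⟪T x, (y : H)⟫_ℂ = ⟪(x : H), T y⟫_ℂ) (x : H) :
    adjoint (tildeTFactor T) (tildeTFactor T x) = x + tildeT T (-1) x := by
  exact adjoint_comp_self_eq_block (isSelfAdjoint_cornerA T hsym) (norm_cornerA_le T hT)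
    (ι := (defectSpace (cornerA T)).subtypeL) (δ := defectTo (cornerA T)) (Γ := gammaTwo T)
    (κ := (defectSpace (adjoint (gammaTwo T))).subtypeL) (ε := defectTo (adjoint (gammaTwo T)))
    (p := K.orthogonalProjectionOnto) (q := Kᗮ.orthogonalProjectionOnto)
    (Submodule.adjoint_subtypeL _) Submodule.orthogonalProjectionOnto_mem_subspace_eq_self
    (fun _ => rfl) ((adjoint.norm_map _).trans_le (norm_gammaTwo_le T hT)) (fun _ => rfl)
    (Submodule.adjoint_orthogonalProjectionOnto _) (Submodule.adjoint_orthogonalProjectionOnto _)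
    coe_projection_add_coe_projection_orthogonal x

/-- On K the factor is (I+A)^{1/2}. The other column applies (I-A)^{1/2} to vectors of 𝒟_A only, so
it stays in the closure of ran (I+A)^{1/2}. -/
theorem tildeTFactor_mem_closure (hT : ‖T‖ ≤ 1)
    (hsym : ∀ x y : K, ⟪T x, (y : H)⟫_ℂ = ⟪(x : H), T y⟫_ℂ) (x : H) :
    tildeTFactor T x ∈ closure (Set.range fun k : K => tildeTFactor T k) := by
  have hr : (Set.range fun k : K => tildeTFactor T k)
      = (LinearMap.range (sqrtOneAdd (cornerA T)).toLinearMap : Set K) := by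
    ext; simp [tildeTFactor_coe]
  rw [hr, ← Submodule.topologicalClosure_coe, SetLike.mem_coe]
  exact add_mem (Submodule.le_topologicalClosure _ (LinearMap.mem_range_self _ _))
    (sqrtOneAdd_neg_mem_closure_range (isSelfAdjoint_cornerA T hsym) (norm_cornerA_le T hT)
      (Submodule.coe_mem _))

end Completion

/-! ### Inverse Cayley transforms and the Friedrichs extension. -/

section Cayley

variable {R : H →L[ℂ] H}

/-- Injectivity of I + R makes the relation x + Rx ↦ x - Rx single-valued, so it is a graph. -/
theorem mem_graph_cayley_toPMap (hR : ∀ x, x + R x = 0 → x = 0) (z : H × H) :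
    z ∈ (cayley (R.toLinearMap.toPMap ⊤)).graph ↔ ∃ x, x + R x = z.1 ∧ x - R x = z.2 := by
  rw [cayley, Submodule.toLinearPMap_graph_eq]
  · constructor
    · rintro ⟨x, rfl⟩
      exact ⟨x, rfl, rfl⟩
    · rintro ⟨x, h1, h2⟩
      exact ⟨⟨x, trivial⟩, Prod.ext h1 h2⟩
  · rintro _ ⟨x, rfl⟩ h
    have hx : (x : H) = 0 := hR x h
    change (x : H) - R x = 0
    rw [hx, map_zero, sub_zero]

end Cayley

namespace PositiveClosedOperator

variable (S : PositiveClosedOperator H)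

theorem inner_T_symm (x y : (cayley S.op).domain) :
    ⟪S.T x, (y : H)⟫_ℂ = ⟪(x : H), S.T y⟫_ℂ := by
  obtain ⟨x, hx⟩ := x
  obtain ⟨y, hy⟩ := y
  obtain ⟨h, rfl⟩ := (S.mem_domain_cayley x).1 hx
  obtain ⟨g, rfl⟩ := (S.mem_domain_cayley y).1 hy
  have h1 : S.T ⟨_, hx⟩ = h - S.op h := S.cayley_apply h hx
  have h2 : S.T ⟨_, hy⟩ = g - S.op g := S.cayley_apply g hy
  rw [h1, h2]
  simp only [inner_sub_left, inner_add_right, inner_sub_right, inner_add_left, S.symmetric h g]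
  ring

/-- A vector `ζ ∈ dom F` with `S* ζ = -ζ` vanishes. -/
theorem eq_zero_of_mem_friedrichsDomain {ζ : H} (hζ : ζ ∈ S.friedrichsDomain)
    (h : ∀ g : S.op.domain, ⟪ζ, S.op g⟫_ℂ = -⟪ζ, (g : H)⟫_ℂ) : ζ = 0 := by
  obtain ⟨-, u, hu, hu'⟩ := hζ
  have hlim : Tendsto (fun m => RCLike.re ⟪ζ, (u m : H)⟫_ℂ) atTop (𝓝 (‖ζ‖ ^ 2)) := by
    rw [← inner_self_eq_norm_sq (𝕜 := ℂ) ζ]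
    exact (RCLike.continuous_re.tendsto _).comp (tendsto_const_nhds.inner hu)
  -- Dropping the nonnegative diagonal terms from the form at uₙ - uₘ leaves Re⟨uₙ, Suₘ⟩ ≥ -ε.
  -- Letting n → ∞ turns this into Re⟨ζ, uₘ⟩ ≤ ε, and then m → ∞ gives ‖ζ‖² ≤ ε.
  have hle : ‖ζ‖ ^ 2 ≤ 0 := by
    refine le_of_forall_pos_le_add fun ε hε => ?_
    rw [zero_add]
    obtain ⟨N, hN⟩ := Filter.eventually_atTop.1 (Metric.tendsto_nhds.1 hu' ε hε)
    refine le_of_tendsto hlim (eventually_atTop.2 ⟨N.2, fun m hm => ?_⟩)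
    have hm' : Tendsto (fun n => RCLike.re ⟪(u n : H), S.op (u m)⟫_ℂ) atTop
        (𝓝 (-RCLike.re ⟪ζ, (u m : H)⟫_ℂ)) := by
      rw [← map_neg, ← h]
      exact (RCLike.continuous_re.tendsto _).comp (hu.inner tendsto_const_nhds)
    refine neg_le_neg_iff.1 (ge_of_tendsto hm' (eventually_atTop.2 ⟨N.1, fun n hn => ?_⟩))
    have h1 := hN (n, m) ⟨hn, hm⟩
    rw [dist_zero_right] at h1
    have h2 := (RCLike.re_le_norm _).trans h1.le
    have h3 := S.nonneg (u n)
    have h4 := S.nonneg (u m)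
    rw [inner_re_symm] at h3 h4
    have h5 : RCLike.re ⟪(u m : H), S.op (u n)⟫_ℂ = RCLike.re ⟪(u n : H), S.op (u m)⟫_ℂ := by
      rw [← S.symmetric (u m) (u n), inner_re_symm]
    simp only [LinearPMap.map_sub, Submodule.coe_sub, inner_sub_left, inner_sub_right,
      map_sub] at h2
    linarith
  exact norm_eq_zero.1 (pow_eq_zero_iff two_ne_zero |>.1 (le_antisymm hle (sq_nonneg _)))

/-- If `I + R = V* V` for an operator `R` that extends the Cayley transform of `S`, and `V` maps
the domain of that Cayley transform onto a dense subset of its range, then the inverse Cayley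
transform of `R` is the Friedrichs extension. -/
theorem cayley_eq_friedrichs {V : H →L[ℂ] E} {R : H →L[ℂ] H}
    (hV : ∀ x, adjoint V (V x) = x + R x) (hS : ∀ h : S.op.domain, R (h + S.op h) = h - S.op h)
    (hcl : ∀ x, V x ∈ closure (Set.range fun h : S.op.domain => V (h + S.op h))) :
    cayley (R.toLinearMap.toPMap ⊤) = S.friedrichs := by
  have hsymm (x y : H) : ⟪R x, y⟫_ℂ = ⟪x, R y⟫_ℂ := by
    have h1 : R x = adjoint V (V x) - x := by rw [hV]; abel
    have h2 : R y = adjoint V (V y) - y := by rw [hV]; abel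
    rw [h1, h2, inner_sub_left, inner_sub_right, adjoint_inner_left, adjoint_inner_right]
  have hadd (h : S.op.domain) : adjoint V (V (h + S.op h)) = (2 : ℂ) • (h : H) := by
    rw [hV, hS, two_smul]; abel
  -- Symmetry of R tested against h + Sh shows that S* maps x + Rx to x - Rx.
  have hadj (x : H) (h : S.op.domain) : ⟪x - R x, (h : H)⟫_ℂ = ⟪x + R x, S.op h⟫_ℂ := by
    have h1 := hsymm x (h + S.op h)
    rw [hS] at h1
    simp only [inner_sub_right, inner_add_right] at h1
    rw [inner_sub_left, inner_add_left]
    linear_combination -h1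
  have hinj (x : H) (hx : x + R x = 0) : x = 0 := by
    refine S.dense.eq_zero_of_inner_left ℂ fun g hg => ?_
    have h1 := hadj x ⟨g, hg⟩
    rw [hx, inner_zero_left, ← neg_eq_of_add_eq_zero_right hx, sub_neg_eq_add, ← two_smul ℂ x,
      inner_smul_left] at h1
    simpa using h1
  have hmem (x : H) : x + R x ∈ S.op.adjoint.domain :=
    LinearPMap.mem_adjoint_domain_of_exists _ ⟨x - R x, hadj x⟩
  have hfr (x : H) : x + R x ∈ S.friedrichsDomain := by
    refine ⟨hmem x, ?_⟩
    obtain ⟨v, hv, hvx⟩ := mem_closure_iff_seq_limit.1 (hcl x)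
    choose h hh using hv
    refine ⟨fun n => (2 : ℂ) • h n, ?_, ?_⟩
    · rw [← hV]
      refine (((adjoint V).continuous.tendsto _).comp hvx).congr fun n => ?_
      rw [Function.comp_apply, ← hh, hadd, Submodule.coe_smul]
    · have hw : Tendsto (fun p : ℕ × ℕ => v p.1 - v p.2) atTop (𝓝 0) := by
        rw [← sub_self (V x), ← prod_atTop_atTop_eq]
        exact (hvx.comp tendsto_fst).sub (hvx.comp tendsto_snd)
      -- For w = V(h + Sh) one has 2h = V*w and 2Sh = 2(h + Sh) - V*w, so this is the form of S at
      -- 2h.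
      have hc : Continuous fun w : E => ⟪w, (2 : ℂ) • w - V (adjoint V w)⟫_ℂ := by fun_prop
      have hz := (hc.tendsto 0).comp hw
      rw [inner_zero_left] at hz
      refine hz.congr fun p => ?_
      have hp : v p.1 - v p.2 = V ((h p.1 - h p.2 : S.op.domain) + S.op (h p.1 - h p.2)) := by
        rw [← hh, ← hh, ← map_sub, LinearPMap.map_sub, Submodule.coe_sub]
        congr 1; abel
      rw [Function.comp_apply, hp, ← smul_sub, LinearPMap.map_smul, Submodule.coe_smul, hadd,
        ← map_smul, ← map_sub, ← adjoint_inner_left, hadd]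
      congr 1
      rw [smul_add, add_sub_cancel_left]
  have hle : cayley (R.toLinearMap.toPMap ⊤) ≤ S.friedrichs := by
    refine LinearPMap.le_of_le_graph fun z hz => ?_
    obtain ⟨x, h1, h2⟩ := (mem_graph_cayley_toPMap hinj z).1 hz
    refine (LinearPMap.mem_graph_iff _).2 ⟨⟨x + R x, hfr x, hmem x⟩, h1, ?_⟩
    refine .trans ?_ h2
    exact (LinearPMap.domRestrict_apply (y := ⟨x + R x, hmem x⟩) rfl).trans
      (LinearPMap.adjoint_apply_eq S.dense _ (hadj x))
  refine LinearPMap.eq_of_le_of_domain_eq hle (le_antisymm hle.1 fun ξ hξ => ?_)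
  obtain ⟨hξF, hξ⟩ := hξ
  -- If ξ = x + Rx, then S*ξ = x - Rx, and adding the two forces this x.
  set x := (2 : ℂ)⁻¹ • (ξ + S.op.adjoint ⟨ξ, hξ⟩) with hx
  have h2x : x + x = ξ + S.op.adjoint ⟨ξ, hξ⟩ := by
    rw [← two_smul ℂ x, hx, smul_inv_smul₀ two_ne_zero]
  -- S*ξ = 2x - ξ and S*(x + Rx) = x - Rx, so S* acts as -1 on the difference, which lies in dom F.
  have hζ : ξ - (x + R x) = 0 := by
    refine S.eq_zero_of_mem_friedrichsDomain (sub_mem hξF (hfr x)) fun g => ?_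
    have h1 : ⟪S.op.adjoint ⟨ξ, hξ⟩, (g : H)⟫_ℂ = ⟪ξ, S.op g⟫_ℂ :=
      LinearPMap.adjoint_isFormalAdjoint S.dense ⟨ξ, hξ⟩ g
    rw [eq_sub_of_add_eq' h2x.symm] at h1
    have h2 := hadj x g
    simp only [inner_sub_left, inner_add_left] at h1 h2 ⊢
    linear_combination h2 - h1
  rw [sub_eq_zero.1 hζ]
  exact LinearPMap.mem_domain_of_mem_graph
    ((mem_graph_cayley_toPMap hinj (x + R x, x - R x)).2 ⟨x, rfl, rfl⟩)

end PositiveClosedOperator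

end KreinFriedrichs

end

theorem proposition4p3 {H : Type*} [NormedAddCommGroup H] [InnerProductSpace ℂ H] [CompleteSpace H]
    (S : KreinFriedrichs.PositiveClosedOperator H) :
    S.extension (-1) = S.friedrichs := by
  refine S.cayley_eq_friedrichs
    (KreinFriedrichs.adjoint_tildeTFactor_comp_self S.T S.norm_T_le S.inner_T_symm) (fun h => ?_)
    fun x => ?_
  · have hx := (S.mem_domain_cayley _).2 ⟨h, rfl⟩
    exact (KreinFriedrichs.tildeT_coe S.T S.norm_T_le _ ⟨_, hx⟩).trans (S.cayley_apply h hx)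
  · refine closure_mono ?_
      (KreinFriedrichs.tildeTFactor_mem_closure S.T S.norm_T_le S.inner_T_symm x)
    rintro _ ⟨⟨k, hk⟩, rfl⟩
    obtain ⟨h, rfl⟩ := (S.mem_domain_cayley k).1 hk
    exact ⟨h, rfl⟩
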